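/- Let $k,j$ be integers with $1\le k<j\le 3$. Put $c_{1,2}=\frac79$, $c_{1,3}=\frac12$, $c_{2,3}=\frac7{18}$, and $$\Theta_{k,j}=c_{k,j}\prod_{p>3}\left(1-\frac{2+\left(\frac{-k}{p}\right)+\left(\frac{-j}{p}\right)}{p^2}\right),$$ where the (convergent) product runs over the primes $p>3$ and $\left(\frac{\cdot}{p}\right)$ is the Legendre symbol. Then for every $\varepsilon>0$, as the real number $X$ tends to infinity, $$\sum_{n\le X}\mu^2(n^2+k)\,\mu^2(n^2+j)=\Theta_{k,j}\,X+O\left(X^{\frac23+\varepsilon}\right),$$ where the sum runs over the positive integers $n\le X$, $\mu$ is the Möbius function, and the implied constant may depend on $\varepsilon$. The left-hand side is the number of positive integers $n\le X$ for which $n^2+k$ and $n^2+j$ are both squarefree. -/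

import Mathlib

open Filter Asymptotics

noncomputable section

namespace NearSquare

/-- The sum of `μ²(n² + k) μ²(n² + j)` over the positive integers `n ≤ X`; it counts the `n ≤ X`
for which `n² + k` and `n² + j` are both squarefree. -/
def pairSum (k j : ℕ) (X : ℝ) : ℝ :=
  ∑ n ∈ Finset.Icc 1 ⌊X⌋₊,
    (ArithmeticFunction.moebius (n ^ 2 + k) : ℝ) ^ 2 *
      (ArithmeticFunction.moebius (n ^ 2 + j) : ℝ) ^ 2

/-- The contribution `c_{k,j}` of the primes `2` and `3`, for `1 ≤ k < j ≤ 3` (the value at any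
other pair is irrelevant). -/
def smallPrimesConst : ℕ → ℕ → ℝ
  | 1, 2 => 7 / 9
  | 1, 3 => 1 / 2
  | 2, 3 => 7 / 18
  | _, _ => 0

/-- The primes `p > 3`. -/
abbrev LargePrime : Type := {p : Nat.Primes // 3 < (p : ℕ)}

/-- The Euler factor `1 - (2 + (-k/p) + (-j/p)) / p²` at a prime `p > 3`, with Legendre symbols. -/
def eulerFactor (k j : ℕ) (p : LargePrime) : ℝ :=
  haveI : Fact (Nat.Prime (p.1 : ℕ)) := ⟨p.1.2⟩
  1 - (2 + (legendreSym (p.1 : ℕ) (-(k : ℤ)) : ℝ) + (legendreSym (p.1 : ℕ) (-(j : ℤ)) : ℝ)) /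
    ((p.1 : ℕ) : ℝ) ^ 2

/-- The constant `Θ`, namely `c_{k,j} ∏_{p > 3} (1 - (2 + (-k/p) + (-j/p)) / p²)`. -/
def theta (k j : ℕ) : ℝ :=
  smallPrimesConst k j * ∏' p : LargePrime, eulerFactor k j p

end NearSquare

end

/-!
Write `F(n) = (n² + k)(n² + j)`. For the pairs in question a prime whose square divides `F(n)` has
its square dividing one of the factors (`prime_sq_dvd_or_of_dvd_quartic`), so `n² + k` and `n² + j`
are both squarefree exactly when `F(n)` is, and the summand is `∑_{d² ∣ F(n)} μ(d)`. The sum over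
`d` is cut at `X ^ (2/3)`.

*Small `d`.* The number of `n ≤ X` with `d² ∣ F(n)` is `X ρ(d) / d² + O(ρ(d))`, where `ρ(d)` counts
the roots of `F` modulo `d²`. The function `ρ` is multiplicative, equals `2 + (-k/p) + (-j/p)` at
primes `p > 3` (Hensel lifting, `rootCount_prime`) and is `O(d ^ δ)` on squarefree `d`. Hence these
`d` contribute `X ∑ μ(d) ρ(d) / d² + O(X ^ (2/3 + ε))`, and the completed series is the Euler
product `Θ` (`tsum_densityCoeff`).

*Large `d`.* A squarefree `d > X ^ (2/3)` with `d² ∣ F(n)` is a product `d₁ d₂` with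
`d₁² ∣ n² + k` and `d₂² ∣ n² + j`, so `d₁` or `d₂` exceeds `X ^ (1/3)`. By the divisor bound it is
enough to show that `O(X ^ (2/3 + ε))` of the `n ≤ X` have `n² + l` divisible by the square of some
squarefree `d > X ^ (1/3)`, for `l = k, j` (`card_exceptional_le`). For `d ≤ X ^ (2/3)` this
follows by counting roots modulo `d²`. For `d > X ^ (2/3)`, write `n² + l = m d²` with
`m = O(X ^ (2/3))`; for each `m` the solutions in a fixed residue class modulo `l` at least double
from one to the next (`two_mul_le_of_solutions`), so there are `O(log X)` of them.
-/

namespace NearSquare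

/-! ### The divisor bound -/

/-- `e + 1 ≤ K * 2 ^ (e δ)` with `K` independent of `e`. -/
lemma succ_le_mul_two_rpow {δ : ℝ} (hδ : 0 < δ) (e : ℕ) :
    (e + 1 : ℝ) ≤ max 1 (1 / (δ * Real.log 2)) * (2 : ℝ) ^ (e * δ) := by
  have hL : 0 < δ * Real.log 2 := mul_pos hδ (Real.log_pos one_lt_two)
  have h1 : 1 + e * (δ * Real.log 2) ≤ (2 : ℝ) ^ (e * δ) := by
    rw [Real.rpow_def_of_pos two_pos]
    have := Real.add_one_le_exp (Real.log 2 * (e * δ))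
    linarith
  have h2 : (1 : ℝ) ≤ max 1 (1 / (δ * Real.log 2)) := le_max_left _ _
  have h3 : 1 ≤ max 1 (1 / (δ * Real.log 2)) * (δ * Real.log 2) := by
    rw [← div_le_iff₀ hL]; exact le_max_right _ _
  calc (e + 1 : ℝ) ≤ max 1 (1 / (δ * Real.log 2)) * (1 + e * (δ * Real.log 2)) := by
        nlinarith [mul_le_mul_of_nonneg_left h3 (Nat.cast_nonneg (α := ℝ) e)]
    _ ≤ _ := by gcongr

/-- The divisor bound `τ(n) = O(n ^ δ)`. -/
lemma exists_card_divisors_le {δ : ℝ} (hδ : 0 < δ) :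
    ∃ C : ℝ, 1 ≤ C ∧ ∀ n : ℕ, n ≠ 0 → (n.divisors.card : ℝ) ≤ C * (n : ℝ) ^ δ := by
  set K : ℝ := max 1 (1 / (δ * Real.log 2)) with hK
  have hK1 : 1 ≤ K := le_max_left _ _
  -- primes `p ≥ P` have `p ^ δ ≥ 2`, and then `e + 1 ≤ 2 ^ e ≤ p ^ (e δ)`
  set P : ℕ := ⌈(2 : ℝ) ^ (1 / δ)⌉₊ with hP
  refine ⟨K ^ P, one_le_pow₀ hK1, fun n hn ↦ ?_⟩
  have key : ∀ p ∈ n.primeFactors, ((n.factorization p + 1 : ℕ) : ℝ) ≤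
      (if p < P then K else 1) * ((p : ℝ) ^ n.factorization p) ^ δ := by
    intro p hp
    have hp2 : (2 : ℝ) ≤ p := by exact_mod_cast (Nat.prime_of_mem_primeFactors hp).two_le
    have hpow : ((p : ℝ) ^ n.factorization p) ^ δ = (p : ℝ) ^ (n.factorization p * δ) := by
      rw [← Real.rpow_natCast, ← Real.rpow_mul (by linarith)]
    rw [hpow]
    push_cast
    split_ifs with h
    · refine (succ_le_mul_two_rpow hδ _).trans ?_
      gcongr
    · have h2 : (2 : ℝ) ≤ (p : ℝ) ^ δ := by
        have : (2 : ℝ) ^ (1 / δ) ≤ p := (Nat.le_ceil _).trans (by exact_mod_cast not_lt.mp h)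
        calc (2 : ℝ) = ((2 : ℝ) ^ (1 / δ)) ^ δ := by
              rw [← Real.rpow_mul two_pos.le, one_div_mul_cancel hδ.ne', Real.rpow_one]
          _ ≤ _ := by gcongr
      rw [one_mul, mul_comm _ δ, Real.rpow_mul (by linarith), Real.rpow_natCast]
      calc ((n.factorization p : ℝ) + 1) ≤ (2 : ℝ) ^ n.factorization p := by
            exact_mod_cast Nat.lt_two_pow_self
        _ ≤ _ := by gcongr
  have hprod : (n : ℝ) ^ δ = ∏ p ∈ n.primeFactors, ((p : ℝ) ^ n.factorization p) ^ δ := by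
    rw [Real.finsetProd_rpow _ _ (fun _ _ ↦ by positivity)]
    congr 1
    conv_lhs => rw [← Nat.prod_factorization_pow_eq_self hn]
    simp [Finsupp.prod]
  rw [Nat.card_divisors hn, Nat.cast_prod, hprod]
  refine (Finset.prod_le_prod (fun _ _ ↦ by positivity) key).trans ?_
  rw [Finset.prod_mul_distrib]
  gcongr
  rw [Finset.prod_ite, Finset.prod_const_one, mul_one, Finset.prod_const]
  refine pow_le_pow_right₀ hK1 ?_
  calc _ ≤ (Finset.range P).card := Finset.card_le_card fun p hp ↦ by
        simpa using (Finset.mem_filter.mp hp).2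
    _ = P := Finset.card_range P

/-! ### Squarefree numbers and the Möbius function -/

lemma dvd_of_sq_dvd_sq_mul {a b d : ℕ} (hb : Squarefree b) (ha : a ≠ 0) (h : d ^ 2 ∣ a ^ 2 * b) :
    d ∣ a := by
  obtain ⟨g, d', a', hg, hco, rfl, rfl⟩ :=
    Nat.exists_coprime' (m := d) (n := a) (Nat.gcd_pos_of_pos_right _ (Nat.pos_of_ne_zero ha))
  have h1 : d' ^ 2 ∣ a' ^ 2 * b := by
    have : g ^ 2 * d' ^ 2 ∣ g ^ 2 * (a' ^ 2 * b) := by convert h using 1 <;> ring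
    exact Nat.dvd_of_mul_dvd_mul_left (by positivity) this
  have h2 : d' * d' ∣ b := by
    rw [← sq]; exact (Nat.Coprime.pow 2 2 hco).dvd_of_dvd_mul_left h1
  have : d' = 1 := by simpa using hb d' h2
  simp [this]

/-- `μ² (m) = ∑_{d² ∣ m} μ(d)`. -/
lemma moebius_sq_eq_sum {m : ℕ} (hm : m ≠ 0) :
    ((ArithmeticFunction.moebius m : ℤ) : ℝ) ^ 2 =
      ∑ d ∈ m.divisors with d ^ 2 ∣ m, (ArithmeticFunction.moebius d : ℝ) := by
  obtain ⟨b, a, hab, hb⟩ := Nat.sq_mul_squarefree m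
  have ha : a ≠ 0 := by rintro rfl; simp at hab; exact hm hab.symm
  have hset : (m.divisors.filter fun d ↦ d ^ 2 ∣ m) = a.divisors := by
    ext d
    simp only [Finset.mem_filter, Nat.mem_divisors, ne_eq, hm, not_false_eq_true, and_true, ha]
    constructor
    · rintro ⟨-, h⟩
      exact dvd_of_sq_dvd_sq_mul hb ha (by rw [mul_comm, ← hab] at *; simpa [mul_comm] using h)
    · intro h
      have h2 : d ^ 2 ∣ m := hab ▸ (pow_dvd_pow_of_dvd h 2).mul_right b
      exact ⟨(dvd_pow_self d two_ne_zero).trans h2, h2⟩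
  have hsq : Squarefree m ↔ a = 1 := by
    constructor
    · intro h
      exact Nat.isUnit_iff.mp (h a ⟨b, by rw [← hab]; ring⟩)
    · rintro rfl
      rw [← hab]; simpa using hb
  have hsum : ∑ d ∈ a.divisors, ArithmeticFunction.moebius d = if a = 1 then 1 else 0 := by
    rw [← ArithmeticFunction.coe_zeta_mul_apply, ArithmeticFunction.coe_zeta_mul_moebius,
      ArithmeticFunction.one_apply]
  rw [hset, ← Int.cast_sum, hsum, ← Int.cast_pow, ArithmeticFunction.moebius_sq]
  simp only [hsq]

/-! ### The equations `n² + k = m d²` -/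

/-- Two solutions of `n² + k = m d²` that agree modulo `k` grow geometrically: the larger `n` is at
least twice the smaller. In `ℤ[√m]` the quotient of `n₁ + d₁ √m` by `n₂ + d₂ √m` is then a unit of
norm `1`. The proof uses only that `n₁ d₂ - n₂ d₁` is a positive multiple of `k`; in particular `m`
may be a square. -/
lemma two_mul_le_of_solutions {k m n₁ d₁ n₂ d₂ : ℕ} (hk : 1 ≤ k) (hk3 : k ≤ 3)
    (h₁ : n₁ ^ 2 + k = m * d₁ ^ 2) (h₂ : n₂ ^ 2 + k = m * d₂ ^ 2) (hlt : n₂ < n₁)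
    (hn : n₁ ≡ n₂ [MOD k]) (hd : d₁ ≡ d₂ [MOD k]) : 2 * n₂ ≤ n₁ := by
  have hm : 0 < m := Nat.pos_of_ne_zero (by rintro rfl; omega)
  have hd₁ : 0 < d₁ := Nat.pos_of_ne_zero (by rintro rfl; simp at h₁; omega)
  zify at h₁ h₂ hlt hm hd₁ hk hk3 ⊢
  have hdvd : (k : ℤ) ∣ n₁ * d₂ - n₂ * d₁ := by
    rw [← Int.modEq_iff_dvd]
    have hn' := (Int.natCast_modEq_iff).mpr hn
    have hd' := (Int.natCast_modEq_iff).mpr hd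
    exact hn'.symm.mul hd'
  have e1 : (n₁ * d₂ - n₂ * d₁ : ℤ) * (n₁ * d₂ + n₂ * d₁) = k * (d₁ ^ 2 - d₂ ^ 2) := by
    linear_combination (d₂ : ℤ) ^ 2 * h₁ - (d₁ : ℤ) ^ 2 * h₂
  have hdd : (0 : ℤ) < d₁ ^ 2 - d₂ ^ 2 := by
    have : (m : ℤ) * (d₁ ^ 2 - d₂ ^ 2) = n₁ ^ 2 - n₂ ^ 2 := by linear_combination h₂ - h₁
    have h3 : (0 : ℤ) < n₁ ^ 2 - n₂ ^ 2 := by nlinarith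
    exact pos_of_mul_pos_right (this ▸ h3) hm.le
  have hsum : (0 : ℤ) ≤ n₁ * d₂ + n₂ * d₁ := by positivity
  have hpos : (0 : ℤ) < n₁ * d₂ - n₂ * d₁ := by
    have : (0 : ℤ) < (n₁ * d₂ - n₂ * d₁) * (n₁ * d₂ + n₂ * d₁) := by
      rw [e1]; exact mul_pos (by linarith) hdd
    exact pos_of_mul_pos_left this hsum
  have hle : (k : ℤ) ≤ n₁ * d₂ - n₂ * d₁ := Int.le_of_dvd hpos hdvd
  have h4 : (n₁ * d₂ + n₂ * d₁ : ℤ) ≤ d₁ ^ 2 - d₂ ^ 2 := by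
    have : (k : ℤ) * (n₁ * d₂ + n₂ * d₁) ≤ k * (d₁ ^ 2 - d₂ ^ 2) :=
      (mul_le_mul_of_nonneg_right hle hsum).trans e1.le
    exact le_of_mul_le_mul_left this (by linarith)
  have h5 : (2 * n₂ : ℤ) < d₁ := by
    have : (2 * n₂ : ℤ) * d₁ < d₁ * d₁ := by nlinarith [sq_nonneg (d₂ : ℤ)]
    exact lt_of_mul_lt_mul_right this hd₁.le
  -- `d₁² ≤ m d₁² = n₁² + k`, and `k ≤ 3`.
  have h6 : (d₁ : ℤ) ≤ n₁ + 1 := by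
    by_contra! h
    have : (n₁ + 2 : ℤ) * (n₁ + 2) ≤ d₁ * d₁ := by
      exact mul_le_mul (by omega) (by omega) (by positivity) hd₁.le
    nlinarith [Int.natCast_nonneg n₂]
  omega

/-- A set of positive integers `≤ N` in which each element is at least twice the previous one has
at most `log₂ N + 1` elements. -/
lemma card_le_log_of_doubling {N : ℕ} {T : Finset ℕ} (hT : T ⊆ Finset.Icc 1 N)
    (h : ∀ a ∈ T, ∀ b ∈ T, a < b → 2 * a ≤ b) : T.card ≤ Nat.log 2 N + 1 := by
  have hlt : ∀ a ∈ T, ∀ b ∈ T, a < b → Nat.log 2 a < Nat.log 2 b := by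
    intro a ha b hb hab
    have ha1 : a ≠ 0 := by have := Finset.mem_Icc.mp (hT ha); omega
    calc Nat.log 2 a < Nat.log 2 (a * 2) := by
          rw [Nat.log_mul_base (by norm_num) ha1]; omega
      _ ≤ _ := Nat.log_mono_right (by linarith [h a ha b hb hab])
  rw [← Finset.card_range (Nat.log 2 N + 1)]
  refine Finset.card_le_card_of_injOn (Nat.log 2) ?_ ?_
  · intro a ha
    have := Finset.mem_Icc.mp (hT ha)
    simpa [Nat.lt_succ_iff] using Nat.log_mono_right this.2
  · intro a ha b hb hab
    rcases lt_trichotomy a b with h1 | h1 | h1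
    · exact absurd hab (hlt a ha b hb h1).ne
    · exact h1
    · exact absurd hab (hlt b hb a ha h1).ne'

open Classical in
/-- For a fixed `m`, the equation `n² + k = m d²` has `O(log N)` solutions with `n ≤ N`. -/
lemma card_solutions_le {k : ℕ} (hk : 1 ≤ k) (hk3 : k ≤ 3) (m N : ℕ) :
    ((Finset.Icc 1 N).filter fun n ↦ ∃ d, n ^ 2 + k = m * d ^ 2).card ≤
      9 * (Nat.log 2 N + 1) := by
  set S := (Finset.Icc 1 N).filter fun n ↦ ∃ d, n ^ 2 + k = m * d ^ 2 with hS
  -- Sort the solutions `(n, d)` by their residues modulo `k`: at most `k² ≤ 9` classes.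
  have hex : ∀ n : ℕ, ∃ d, n ∈ S → n ^ 2 + k = m * d ^ 2 := fun n ↦ by
    by_cases hn : n ∈ S
    · obtain ⟨d, hd⟩ := (Finset.mem_filter.mp hn).2
      exact ⟨d, fun _ ↦ hd⟩
    · exact ⟨0, fun h ↦ absurd h hn⟩
  choose d hd using hex
  have h1 := Finset.card_le_mul_card_image_of_maps_to (s := S)
    (f := fun n ↦ (n % k, d n % k)) (t := Finset.range k ×ˢ Finset.range k)
    (fun n _ ↦ by simp [Nat.mod_lt _ hk]) (Nat.log 2 N + 1) (fun c _ ↦ by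
      refine card_le_log_of_doubling (fun n hn ↦ ?_) fun a ha b hb hab ↦ ?_
      · exact (Finset.mem_filter.mp (Finset.mem_filter.mp hn).1).1
      · rw [Finset.mem_filter] at ha hb
        have := ha.2.trans hb.2.symm
        simp only [Prod.mk.injEq] at this
        exact two_mul_le_of_solutions hk hk3 (hd b hb.1) (hd a ha.1) hab this.1.symm this.2.symm)
  refine h1.trans ?_
  rw [Finset.card_product, Finset.card_range, mul_comm]
  gcongr
  nlinarith

open Classical in
/-- Few `n ≤ N` have `n² + k` divisible by the square of some `d > Y`: such an `n` solves
`n² + k = m d²` with a small cofactor `m`. -/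
lemma card_large_sq_dvd_le {k : ℕ} (hk : 1 ≤ k) (hk3 : k ≤ 3) {N M : ℕ} {Y : ℝ} (hY : 0 < Y)
    (hM : ((N : ℝ) ^ 2 + 3) / Y ^ 2 ≤ M) :
    ((Finset.Icc 1 N).filter fun n ↦ ∃ d : ℕ, Y < d ∧ d ^ 2 ∣ n ^ 2 + k).card ≤
      M * (9 * (Nat.log 2 N + 1)) := by
  calc _ ≤ ((Finset.Icc 1 M).biUnion fun m ↦
        (Finset.Icc 1 N).filter fun n ↦ ∃ d, n ^ 2 + k = m * d ^ 2).card := by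
        refine Finset.card_le_card fun n hn ↦ ?_
        obtain ⟨hnN, d, hYd, m, hm⟩ := Finset.mem_filter.mp hn
        rw [Finset.mem_biUnion]
        refine ⟨m, Finset.mem_Icc.mpr ⟨Nat.pos_of_ne_zero ?_, ?_⟩,
          Finset.mem_filter.mpr ⟨hnN, d, by rw [hm, mul_comm]⟩⟩
        · rintro rfl; omega
        · have hnN' : (n : ℝ) ≤ N := by exact_mod_cast (Finset.mem_Icc.mp hnN).2
          have hk3' : (k : ℝ) ≤ 3 := by exact_mod_cast hk3
          have hm' : (n : ℝ) ^ 2 + k = d ^ 2 * m := by exact_mod_cast hm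
          have : (m : ℝ) ≤ M := by
            refine le_trans ?_ hM
            rw [le_div_iff₀ (by positivity)]
            calc (m : ℝ) * Y ^ 2 ≤ m * d ^ 2 := by gcongr
              _ = (n : ℝ) ^ 2 + k := by rw [hm', mul_comm]
              _ ≤ _ := by gcongr
          exact_mod_cast this
    _ ≤ (Finset.Icc 1 M).card * (9 * (Nat.log 2 N + 1)) :=
        Finset.card_biUnion_le_card_mul _ _ _ fun m _ ↦ card_solutions_le hk hk3 m N
    _ = _ := by simp

/-! ### Roots of `(x² + k)(x² + j)` modulo squares -/

/-- The quartic `(n² + k)(n² + j)`, whose squarefreeness is equivalent to that of both factors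
for the pairs `1 ≤ k < j ≤ 3`. -/
def quartic (k j n : ℕ) : ℕ := (n ^ 2 + k) * (n ^ 2 + j)

/-- The number of roots of the quartic modulo `d²`. -/
def rootCount (k j d : ℕ) : ℕ := ((Finset.range (d ^ 2)).filter fun n ↦ d ^ 2 ∣ quartic k j n).card

lemma periodic_sq_dvd_quartic (k j q : ℕ) :
    Function.Periodic (fun n ↦ q ∣ quartic k j n) q := by
  intro n
  beta_reduce
  rw [eq_iff_iff, ← ZMod.natCast_eq_zero_iff, ← ZMod.natCast_eq_zero_iff]
  simp [quartic]

lemma card_filter_Ico_mul_of_periodic {p : ℕ → Prop} [DecidablePred p] {a : ℕ}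
    (hp : Function.Periodic p a) (q : ℕ) :
    ((Finset.Ico 1 (1 + q * a)).filter p).card = q * ((Finset.range a).filter p).card := by
  induction q with
  | zero => simp
  | succ q ih =>
    have h1 : 1 + (q + 1) * a = (1 + q * a) + a := by ring
    have h2 := Nat.filter_Ico_card_eq_of_periodic (1 + q * a) a p hp
    rw [Nat.count_eq_card_filter_range] at h2
    rw [h1, ← Finset.Ico_union_Ico_eq_Ico (b := 1 + q * a) (by omega) (by omega),
      Finset.filter_union, Finset.card_union_of_disjoint, ih, h2]
    · ring
    · exact Finset.disjoint_filter_filter (Finset.Ico_disjoint_Ico_consecutive _ _ _)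

/-- The number of `n ≤ X` with `d² ∣ (n² + k)(n² + j)` is `X ρ(d) / d²` up to `ρ(d)`. -/
lemma abs_card_sub_le (k j : ℕ) {d : ℕ} (hd : 0 < d) {X : ℝ} (hX : 0 ≤ X) :
    |(((Finset.Icc 1 ⌊X⌋₊).filter fun n ↦ d ^ 2 ∣ quartic k j n).card : ℝ) -
      X * rootCount k j d / (d : ℝ) ^ 2| ≤ rootCount k j d := by
  set a := d ^ 2 with ha
  have ha0 : 0 < a := by positivity
  set q := ⌊X / (a : ℝ)⌋₊ with hq
  have hq' : q = ⌊X⌋₊ / a := by rw [hq, Nat.floor_div_natCast]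
  have hper := periodic_sq_dvd_quartic k j a
  have hlow : q * rootCount k j d ≤
      ((Finset.Icc 1 ⌊X⌋₊).filter fun n ↦ a ∣ quartic k j n).card := by
    rw [rootCount, ← card_filter_Ico_mul_of_periodic hper q]
    refine Finset.card_le_card (Finset.filter_subset_filter _ fun n hn ↦ ?_)
    rw [Finset.mem_Ico] at hn
    have := Nat.div_mul_le_self ⌊X⌋₊ a
    rw [Finset.mem_Icc, hq'] at *
    omega
  have hupp : ((Finset.Icc 1 ⌊X⌋₊).filter fun n ↦ a ∣ quartic k j n).card ≤
      (q + 1) * rootCount k j d := by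
    rw [rootCount, ← card_filter_Ico_mul_of_periodic hper (q + 1)]
    refine Finset.card_le_card (Finset.filter_subset_filter _ fun n hn ↦ ?_)
    rw [Finset.mem_Icc] at hn
    have := Nat.lt_mul_div_succ ⌊X⌋₊ ha0
    rw [← hq', mul_comm] at this
    rw [Finset.mem_Ico]
    omega
  have hq1 : (q : ℝ) ≤ X / a := Nat.floor_le (by positivity)
  have hq2 : X / a < q + 1 := Nat.lt_floor_add_one _
  have hlow' := (Nat.cast_le (α := ℝ)).mpr hlow
  have hupp' := (Nat.cast_le (α := ℝ)).mpr hupp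
  push_cast at hlow' hupp'
  have hr : (0 : ℝ) ≤ rootCount k j d := by positivity
  have hdiv : X * rootCount k j d / (d : ℝ) ^ 2 = X / a * rootCount k j d := by
    rw [ha]; push_cast; ring
  rw [hdiv, abs_le]
  constructor
  · nlinarith
  · nlinarith

lemma card_filter_range_eq_natCard (k j : ℕ) {q : ℕ} (hq : 0 < q) :
    ((Finset.range q).filter fun n ↦ q ∣ quartic k j n).card =
      Nat.card {x : ZMod q // (x ^ 2 + k) * (x ^ 2 + j) = 0} := by
  have : NeZero q := ⟨hq.ne'⟩
  classical
  rw [Nat.card_eq_fintype_card, Fintype.card_subtype]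
  refine Finset.card_bij' (fun n _ ↦ (n : ZMod q)) (fun x _ ↦ x.val) ?_ ?_ ?_ ?_
  · intro n hn
    have := (Finset.mem_filter.mp hn).2
    rw [← ZMod.natCast_eq_zero_iff] at this
    simpa [quartic] using this
  · intro x hx
    rw [Finset.mem_filter] at hx ⊢
    refine ⟨Finset.mem_range.mpr (ZMod.val_lt x), ?_⟩
    rw [← ZMod.natCast_eq_zero_iff]
    simpa [quartic] using hx.2
  · intro n hn
    exact ZMod.val_cast_of_lt (Finset.mem_range.mp (Finset.mem_filter.mp hn).1)
  · intro x _
    simp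

lemma rootCount_one (k j : ℕ) : rootCount k j 1 = 1 := by simp [rootCount]

/-- Multiplicativity of the root count, by the Chinese remainder theorem. -/
lemma rootCount_mul (k j : ℕ) {m n : ℕ} (h : m.Coprime n) :
    rootCount k j (m * n) = rootCount k j m * rootCount k j n := by
  rcases Nat.eq_zero_or_pos m with rfl | hm
  · simp [rootCount]
  rcases Nat.eq_zero_or_pos n with rfl | hn
  · simp [rootCount]
  unfold rootCount
  rw [card_filter_range_eq_natCard k j (by positivity), card_filter_range_eq_natCard k j
    (by positivity), card_filter_range_eq_natCard k j (by positivity), ← Nat.card_prod, mul_pow]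
  have e := ZMod.chineseRemainder (Nat.Coprime.pow 2 2 h)
  have h1 : ∀ x : ZMod (m ^ 2 * n ^ 2), (x ^ 2 + k) * (x ^ 2 + j) = 0 ↔
      (((e x).1 ^ 2 + k) * ((e x).1 ^ 2 + j) = 0 ∧ ((e x).2 ^ 2 + k) * ((e x).2 ^ 2 + j) = 0) := by
    intro x
    rw [← map_eq_zero_iff e e.injective, Prod.ext_iff]
    simp
  exact Nat.card_congr ((e.toEquiv.subtypeEquiv h1).trans (Equiv.subtypeProdEquivProd))

section PrimeSquare

variable {p : ℕ}

lemma isUnit_or_cast_eq_zero (hp : p.Prime) (x : ZMod (p ^ 2)) :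
    IsUnit x ∨ ZMod.castHom (dvd_pow_self p two_ne_zero) (ZMod p) x = 0 := by
  have : NeZero (p ^ 2) := ⟨(pow_pos hp.pos 2).ne'⟩
  obtain ⟨n, rfl⟩ := ZMod.natCast_zmod_surjective x
  rw [ZMod.isUnit_iff_coprime, map_natCast, ZMod.natCast_eq_zero_iff]
  rcases Nat.coprime_or_dvd_of_prime hp n with h | h
  · exact Or.inl (Nat.Coprime.pow_right 2 h.symm)
  · exact Or.inr h

/-- `ZMod (p ^ 2)` is local, so two elements whose difference is a unit are not both non-units. -/
lemma eq_zero_or_eq_zero_of_isUnit_sub (hp : p.Prime) {b c : ZMod (p ^ 2)}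
    (hu : IsUnit (b - c)) (h : b * c = 0) : b = 0 ∨ c = 0 := by
  have : Fact p.Prime := ⟨hp⟩
  rcases isUnit_or_cast_eq_zero hp b with hb | hb
  · exact Or.inr ((hb.mul_right_eq_zero).mp h)
  rcases isUnit_or_cast_eq_zero hp c with hc | hc
  · exact Or.inl ((hc.mul_left_eq_zero).mp h)
  exfalso
  have := hu.map (ZMod.castHom (dvd_pow_self p two_ne_zero) (ZMod p))
  rw [map_sub, hb, hc, sub_zero] at this
  exact not_isUnit_zero this

/-- Hensel lifting of a square root of `-k` from `ZMod p` to `ZMod (p ^ 2)`. -/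
lemma exists_sq_add_eq_zero_of_legendreSym [Fact p.Prime] (hp3 : 3 < p) {k : ℕ} (hk : 1 ≤ k)
    (hk3 : k ≤ 3) (h : legendreSym p (-(k : ℤ)) = 1) :
    ∃ a : ZMod (p ^ 2), a ^ 2 + (k : ZMod (p ^ 2)) = 0 := by
  have hp : p.Prime := Fact.out
  have hkp : ¬ (p : ℤ) ∣ k := fun hd ↦ by
    have := Nat.le_of_dvd hk (Int.natCast_dvd_natCast.mp hd); omega
  have hk0 : ((-(k : ℤ) : ℤ) : ZMod p) ≠ 0 := by
    rw [Int.cast_neg, neg_ne_zero]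
    exact fun h ↦ hkp ((ZMod.intCast_zmod_eq_zero_iff_dvd _ _).mp h)
  obtain ⟨y, hy⟩ := (legendreSym.eq_one_iff p hk0).mp h
  obtain ⟨a, rfl⟩ := ZMod.intCast_surjective y
  have ha : (p : ℤ) ∣ a ^ 2 + k := by
    rw [← ZMod.intCast_zmod_eq_zero_iff_dvd]
    push_cast at hy ⊢
    linear_combination -hy
  have hpa : ¬ (p : ℤ) ∣ 2 * a := fun hd ↦ by
    rcases (Nat.prime_iff_prime_int.mp hp).dvd_or_dvd hd with h2 | h2
    · have := Int.le_of_dvd two_pos h2; omega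
    · exact hkp ((dvd_add_right (h2.trans (dvd_pow_self a two_ne_zero))).mp ha)
  obtain ⟨u, v, huv⟩ := (Nat.prime_iff_prime_int.mp hp).coprime_iff_not_dvd.mpr hpa
  obtain ⟨t, ht⟩ := ha
  -- Newton's step from `a`, with `v` the inverse of the derivative `2 a` modulo `p`
  refine ⟨((a - (a ^ 2 + k) * v : ℤ) : ZMod (p ^ 2)), ?_⟩
  have hdvd : ((p ^ 2 : ℕ) : ℤ) ∣ (a - (a ^ 2 + k) * v) ^ 2 + k := by
    refine ⟨t * u + t ^ 2 * v ^ 2, ?_⟩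
    push_cast
    linear_combination (1 - 2 * a * v + v ^ 2 * (a ^ 2 + k + p * t)) * ht - p * t * huv
  rw [← ZMod.intCast_zmod_eq_zero_iff_dvd, Int.cast_add, Int.cast_pow] at hdvd
  exact_mod_cast hdvd

lemma isUnit_natCast_of_small (hp : p.Prime) {c : ℕ} (hc : 1 ≤ c) (hcp : c < p) :
    IsUnit (c : ZMod (p ^ 2)) := by
  rw [ZMod.isUnit_iff_coprime]
  exact Nat.Coprime.pow_right 2 (Nat.coprime_of_lt_prime (by omega) hcp hp).symm

/-- If `-k` is a square modulo `p`, a root `a` lifts to `ZMod (p ^ 2)` and the roots there are exactly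
`a` and `-a`; otherwise there are none. -/
lemma ncard_sq_add_eq_zero [Fact p.Prime] (hp3 : 3 < p) {k : ℕ} (hk : 1 ≤ k) (hk3 : k ≤ 3) :
    (({x : ZMod (p ^ 2) | x ^ 2 + (k : ZMod (p ^ 2)) = 0}.ncard : ℕ) : ℤ) =
      1 + legendreSym p (-(k : ℤ)) := by
  have hp : p.Prime := Fact.out
  have hk0 : ((-(k : ℤ) : ℤ) : ZMod p) ≠ 0 := by
    rw [Int.cast_neg, neg_ne_zero, Int.cast_natCast, Ne, ZMod.natCast_eq_zero_iff]
    exact fun h ↦ by have := Nat.le_of_dvd hk h; omega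
  rcases legendreSym.eq_one_or_neg_one p hk0 with h | h
  · obtain ⟨a, ha⟩ := exists_sq_add_eq_zero_of_legendreSym hp3 hk hk3 h
    have hu : IsUnit (2 * a) := by
      have h2 : IsUnit (a * a) := by
        have : a * a = -(k : ZMod (p ^ 2)) := by linear_combination ha
        rw [this]
        exact (isUnit_natCast_of_small hp hk (by omega)).neg
      exact (by exact_mod_cast isUnit_natCast_of_small hp (c := 2) (by omega) (by omega) :
        IsUnit (2 : ZMod (p ^ 2))).mul (isUnit_of_mul_isUnit_left h2)
    have hset : {x : ZMod (p ^ 2) | x ^ 2 + (k : ZMod (p ^ 2)) = 0} = {a, -a} := by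
      ext x
      simp only [Set.mem_ofPred_eq, Set.mem_insert_iff, Set.mem_singleton_iff]
      constructor
      · intro hx
        have h1 : (x + a) * (x - a) = 0 := by linear_combination hx - ha
        rcases eq_zero_or_eq_zero_of_isUnit_sub hp (by convert hu using 1; ring) h1 with h | h
        · exact Or.inr (eq_neg_of_add_eq_zero_left h)
        · exact Or.inl (sub_eq_zero.mp h)
      · rintro (rfl | rfl)
        · exact ha
        · simpa using ha
    have hne : a ≠ -a := by
      intro he
      have : 2 * a = 0 := by linear_combination he
      rw [this] at hu
      have : Fact (1 < p ^ 2) := ⟨Nat.one_lt_pow two_ne_zero hp.one_lt⟩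
      exact not_isUnit_zero hu
    rw [hset, Set.ncard_pair hne, h]
    norm_num
  · have hset : {x : ZMod (p ^ 2) | x ^ 2 + (k : ZMod (p ^ 2)) = 0} = ∅ := by
      rw [Set.eq_empty_iff_forall_notMem]
      intro x hx
      rw [Set.mem_ofPred_eq] at hx
      have h1 := congrArg (ZMod.castHom (dvd_pow_self p two_ne_zero) (ZMod p)) hx
      rw [map_add, map_pow, map_natCast, map_zero] at h1
      refine (legendreSym.eq_neg_one_iff p).mp h
        ⟨ZMod.castHom (dvd_pow_self p two_ne_zero) (ZMod p) x, ?_⟩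
      push_cast
      linear_combination -h1
    rw [hset, h]
    simp

/-- For `p > 3` the two quadratic factors have no common root modulo `p`, so their roots modulo
`p²` are counted separately. -/
lemma rootCount_prime [Fact p.Prime] (hp3 : 3 < p) {k j : ℕ} (hk : 1 ≤ k) (hkj : k < j)
    (hj : j ≤ 3) : (rootCount k j p : ℤ) =
      2 + legendreSym p (-(k : ℤ)) + legendreSym p (-(j : ℤ)) := by
  have hp : p.Prime := Fact.out
  have : NeZero (p ^ 2) := ⟨(pow_pos hp.pos 2).ne'⟩
  have : Fact (1 < p ^ 2) := ⟨Nat.one_lt_pow two_ne_zero hp.one_lt⟩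
  have hu : IsUnit ((j : ZMod (p ^ 2)) - k) := by
    rw [← Nat.cast_sub hkj.le]
    exact isUnit_natCast_of_small hp (by omega) (by omega)
  have hset :
      {x : ZMod (p ^ 2) | (x ^ 2 + (k : ZMod (p ^ 2))) * (x ^ 2 + (j : ZMod (p ^ 2))) = 0} =
      {x : ZMod (p ^ 2) | x ^ 2 + (k : ZMod (p ^ 2)) = 0} ∪
        {x : ZMod (p ^ 2) | x ^ 2 + (j : ZMod (p ^ 2)) = 0} := by
    ext x
    simp only [Set.mem_ofPred_eq, Set.mem_union]
    constructor
    · intro h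
      refine (eq_zero_or_eq_zero_of_isUnit_sub hp ?_ (mul_comm _ _ |>.trans h)).symm
      convert hu using 1; ring
    · rintro (h | h) <;> simp [h]
  have hdisj : Disjoint {x : ZMod (p ^ 2) | x ^ 2 + (k : ZMod (p ^ 2)) = 0}
      {x : ZMod (p ^ 2) | x ^ 2 + (j : ZMod (p ^ 2)) = 0} := by
    rw [Set.disjoint_left]
    intro x h1 h2
    have : (j : ZMod (p ^ 2)) - k = 0 := by
      simp only [Set.mem_ofPred_eq] at h1 h2
      linear_combination h2 - h1
    rw [this] at hu
    exact not_isUnit_zero hu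
  have h1 : rootCount k j p =
      {x : ZMod (p ^ 2) | (x ^ 2 + (k : ZMod (p ^ 2))) * (x ^ 2 + (j : ZMod (p ^ 2))) = 0}.ncard := by
    rw [rootCount, card_filter_range_eq_natCard k j (pow_pos hp.pos 2)]
    rfl
  rw [h1, hset, Set.ncard_union_eq hdisj, Nat.cast_add,
    ncard_sq_add_eq_zero hp3 hk (by omega), ncard_sq_add_eq_zero hp3 (by omega) hj]
  ring

end PrimeSquare

/-- The primes `2` and `3` account for the constant `c_{k,j}`. -/
lemma smallPrimesConst_eq {k j : ℕ} (hk : 1 ≤ k) (hkj : k < j) (hj : j ≤ 3) :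
    smallPrimesConst k j =
      (1 - (rootCount k j 2 : ℝ) / 2 ^ 2) * (1 - (rootCount k j 3 : ℝ) / 3 ^ 2) := by
  have h : (k = 1 ∧ j = 2) ∨ (k = 1 ∧ j = 3) ∨ (k = 2 ∧ j = 3) := by omega
  rcases h with ⟨rfl, rfl⟩ | ⟨rfl, rfl⟩ | ⟨rfl, rfl⟩
  · rw [show rootCount 1 2 2 = 0 by decide, show rootCount 1 2 3 = 2 by decide, smallPrimesConst]
    norm_num
  · rw [show rootCount 1 3 2 = 2 by decide, show rootCount 1 3 3 = 0 by decide, smallPrimesConst]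
    norm_num
  · rw [show rootCount 2 3 2 = 2 by decide, show rootCount 2 3 3 = 2 by decide, smallPrimesConst]
    norm_num

lemma rootCount_prime_le {k j p : ℕ} (hk : 1 ≤ k) (hkj : k < j) (hj : j ≤ 3) (hp : p.Prime) :
    rootCount k j p ≤ 4 := by
  by_cases hp3 : 3 < p
  · have : Fact p.Prime := ⟨hp⟩
    have h1 : ∀ a : ℤ, legendreSym p a ≤ 1 := fun a ↦ by
      rcases quadraticChar_isQuadratic (ZMod p) (a : ZMod p) with h | h | h <;>
        simp [legendreSym, h]
    have := rootCount_prime hp3 hk hkj hj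
    have := h1 (-k)
    have := h1 (-j)
    omega
  · have h : (k = 1 ∧ j = 2) ∨ (k = 1 ∧ j = 3) ∨ (k = 2 ∧ j = 3) := by omega
    have hp' : p = 2 ∨ p = 3 := by have := hp.two_le; omega
    rcases h with ⟨rfl, rfl⟩ | ⟨rfl, rfl⟩ | ⟨rfl, rfl⟩ <;> rcases hp' with rfl | rfl <;> decide

/-- At a prime, `ρ(p) ≤ 4 = τ(p)²`; multiplicativity gives `ρ(d) ≤ τ(d)²` for squarefree `d`. -/
lemma rootCount_le_of_squarefree {k j : ℕ} (hk : 1 ≤ k) (hkj : k < j) (hj : j ≤ 3) {d : ℕ}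
    (hd : Squarefree d) : rootCount k j d ≤ d.divisors.card ^ 2 := by
  induction d using Nat.recOnPosPrimePosCoprime with
  | zero => simp at hd
  | one => simp [rootCount_one]
  | prime_pow p n hp hn =>
    obtain rfl : n = 1 := (Nat.squarefree_pow_iff hp.ne_one hn.ne').mp hd |>.2
    rw [pow_one, hp.divisors, Finset.card_pair hp.ne_one.symm]
    exact rootCount_prime_le hk hkj hj hp
  | coprime a b ha hb hab iha ihb =>
    rw [rootCount_mul k j hab, hab.card_divisors_mul, mul_pow]
    exact Nat.mul_le_mul (iha (hd.of_mul_left)) (ihb (hd.of_mul_right))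

/-! ### Square divisors of the quartic -/

/-- A common prime factor of `n² + k` and `n² + j` divides `j - k ≤ 2`, so it is `2`; this occurs
only for `(k, j) = (1, 3)` with `n` odd, and then `4 ∣ n² + 3`. -/
lemma prime_sq_dvd_or_of_dvd_quartic {k j n p : ℕ} (hk : 1 ≤ k) (hkj : k < j) (hj : j ≤ 3)
    (hp : p.Prime) (h : p ^ 2 ∣ quartic k j n) : p ^ 2 ∣ n ^ 2 + k ∨ p ^ 2 ∣ n ^ 2 + j := by
  by_cases h1 : p ∣ n ^ 2 + k
  · by_cases h2 : p ∣ n ^ 2 + j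
    · have h3 : p ∣ j - k := by
        have := Nat.dvd_sub h2 h1
        rwa [Nat.add_sub_add_left] at this
      have h4 := Nat.le_of_dvd (by omega) h3
      obtain rfl : p = 2 := by have := hp.two_le; omega
      obtain ⟨rfl, rfl⟩ : k = 1 ∧ j = 3 := by omega
      right
      have hodd : n % 2 = 1 := by
        by_contra hne
        obtain ⟨t, rfl⟩ : 2 ∣ n := by omega
        have : (2 * t) ^ 2 = 2 * (2 * t ^ 2) := by ring
        omega
      obtain ⟨t, rfl⟩ : ∃ t, n = 2 * t + 1 := ⟨n / 2, by omega⟩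
      exact ⟨t ^ 2 + t + 1, by ring⟩
    · have hco := Nat.Coprime.pow_left 2 ((hp.coprime_iff_not_dvd).mpr h2)
      exact Or.inl (hco.dvd_of_dvd_mul_right h)
  · have hco := Nat.Coprime.pow_left 2 ((hp.coprime_iff_not_dvd).mpr h1)
    exact Or.inr (hco.dvd_of_dvd_mul_left h)

lemma squarefree_quartic_iff {k j n : ℕ} (hk : 1 ≤ k) (hkj : k < j) (hj : j ≤ 3) :
    Squarefree (quartic k j n) ↔ Squarefree (n ^ 2 + k) ∧ Squarefree (n ^ 2 + j) := by
  refine ⟨fun h ↦ ⟨h.of_mul_left, h.of_mul_right⟩, fun ⟨h1, h2⟩ ↦ ?_⟩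
  rw [Nat.squarefree_iff_prime_squarefree] at *
  intro p hp hd
  rw [← sq] at hd
  rcases prime_sq_dvd_or_of_dvd_quartic hk hkj hj hp hd with h | h
  · exact h1 p hp (by rwa [← sq])
  · exact h2 p hp (by rwa [← sq])

lemma prod_primes_sq_dvd {s : Finset ℕ} {m : ℕ} (hs : ∀ p ∈ s, p.Prime ∧ p ^ 2 ∣ m) :
    (∏ p ∈ s, p) ^ 2 ∣ m := by
  rw [← Finset.prod_pow]
  refine Finset.prod_dvd_of_isRelPrime (fun p hp q hq hpq ↦ ?_) fun p hp ↦ (hs p hp).2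
  exact Nat.coprime_iff_isRelPrime.mp
    (Nat.Coprime.pow 2 2 ((Nat.coprime_primes (hs p hp).1 (hs q hq).1).mpr hpq))

/-- A squarefree `d` with `d²` dividing the quartic splits as `d₁ d₂` with `d₁²`, `d₂²` dividing the
two quadratic factors. -/
lemma exists_mul_eq_of_sq_dvd_quartic {k j n d : ℕ} (hk : 1 ≤ k) (hkj : k < j) (hj : j ≤ 3)
    (hd : Squarefree d) (h : d ^ 2 ∣ quartic k j n) :
    ∃ d₁ d₂, d₁ * d₂ = d ∧ d₁ ^ 2 ∣ n ^ 2 + k ∧ d₂ ^ 2 ∣ n ^ 2 + j := by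
  refine ⟨∏ p ∈ d.primeFactors.filter (fun p ↦ p ^ 2 ∣ n ^ 2 + k), p,
    ∏ p ∈ d.primeFactors.filter (fun p ↦ ¬ p ^ 2 ∣ n ^ 2 + k), p, ?_, ?_, ?_⟩
  · rw [Finset.prod_filter_mul_prod_filter_not, Nat.prod_primeFactors_of_squarefree hd]
  · refine prod_primes_sq_dvd fun p hp ↦ ?_
    rw [Finset.mem_filter] at hp
    exact ⟨Nat.prime_of_mem_primeFactors hp.1, hp.2⟩
  · refine prod_primes_sq_dvd fun p hp ↦ ?_
    rw [Finset.mem_filter] at hp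
    have hpp := Nat.prime_of_mem_primeFactors hp.1
    refine ⟨hpp, (prime_sq_dvd_or_of_dvd_quartic hk hkj hj hpp ?_).resolve_left hp.2⟩
    exact (pow_dvd_pow_of_dvd (Nat.dvd_of_mem_primeFactors hp.1) 2).trans h

lemma quartic_ne_zero {k j n : ℕ} (hk : 1 ≤ k) (hkj : k < j) : quartic k j n ≠ 0 := by
  exact mul_ne_zero (Nat.add_pos_right _ hk).ne' (Nat.add_pos_right _ (hk.trans hkj.le)).ne'

lemma pairSum_eq {k j : ℕ} (hk : 1 ≤ k) (hkj : k < j) (hj : j ≤ 3) (X : ℝ) :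
    pairSum k j X = ∑ n ∈ Finset.Icc 1 ⌊X⌋₊,
      ∑ d ∈ (quartic k j n).divisors with d ^ 2 ∣ quartic k j n,
        (ArithmeticFunction.moebius d : ℝ) := by
  refine Finset.sum_congr rfl fun n _ ↦ ?_
  rw [← moebius_sq_eq_sum (quartic_ne_zero hk hkj)]
  simp only [← Int.cast_pow, ArithmeticFunction.moebius_sq, squarefree_quartic_iff hk hkj hj]
  by_cases h1 : Squarefree (n ^ 2 + k) <;> by_cases h2 : Squarefree (n ^ 2 + j) <;> simp [h1, h2]

/-! ### The singular series -/

/-- The coefficient `μ(d) ρ(d) / d²` of the singular series. -/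
noncomputable def densityCoeff (k j d : ℕ) : ℝ :=
  (ArithmeticFunction.moebius d : ℝ) * rootCount k j d / (d : ℝ) ^ 2

/-- On squarefree `d`, the root count is `O(d ^ δ)` for every `δ > 0`. -/
lemma exists_moebius_mul_rootCount_le {k j : ℕ} (hk : 1 ≤ k) (hkj : k < j) (hj : j ≤ 3) {δ : ℝ}
    (hδ : 0 < δ) : ∃ C : ℝ, 1 ≤ C ∧ ∀ d : ℕ, 0 < d →
      |(ArithmeticFunction.moebius d : ℝ)| * rootCount k j d ≤ C * (d : ℝ) ^ δ := by
  obtain ⟨C, hC1, hC⟩ := exists_card_divisors_le (half_pos hδ)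
  refine ⟨C ^ 2, one_le_pow₀ hC1, fun d hd ↦ ?_⟩
  rw [← Int.cast_abs, ArithmeticFunction.abs_moebius]
  split_ifs with h
  · rw [Int.cast_one, one_mul]
    calc (rootCount k j d : ℝ) ≤ (d.divisors.card : ℝ) ^ 2 := by
          exact_mod_cast rootCount_le_of_squarefree hk hkj hj h
      _ ≤ (C * (d : ℝ) ^ (δ / 2)) ^ 2 := by gcongr; exact hC d hd.ne'
      _ = C ^ 2 * (d : ℝ) ^ δ := by
          rw [mul_pow, ← Real.rpow_natCast ((d : ℝ) ^ (δ / 2)), ← Real.rpow_mul (by positivity)]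
          norm_num
  · rw [Int.cast_zero, zero_mul]; positivity

lemma exists_abs_densityCoeff_le {k j : ℕ} (hk : 1 ≤ k) (hkj : k < j) (hj : j ≤ 3) :
    ∃ C : ℝ, 0 ≤ C ∧ ∀ d : ℕ, |densityCoeff k j d| ≤ C * (d : ℝ) ^ (-(7 / 4) : ℝ) := by
  obtain ⟨C, hC1, hC⟩ := exists_moebius_mul_rootCount_le hk hkj hj (δ := 1 / 4) (by norm_num)
  refine ⟨C, by linarith, fun d ↦ ?_⟩
  rcases Nat.eq_zero_or_pos d with rfl | hd
  · simp [densityCoeff]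
  · have hd' : (0 : ℝ) < d := by exact_mod_cast hd
    rw [densityCoeff, abs_div, abs_mul, abs_of_nonneg (by positivity : (0 : ℝ) ≤ rootCount k j d),
      abs_of_pos (by positivity : (0 : ℝ) < (d : ℝ) ^ 2), div_le_iff₀ (by positivity)]
    refine (hC d hd).trans_eq ?_
    rw [mul_assoc, ← Real.rpow_natCast (d : ℝ) 2, ← Real.rpow_add hd']
    norm_num

lemma summable_abs_densityCoeff {k j : ℕ} (hk : 1 ≤ k) (hkj : k < j) (hj : j ≤ 3) :
    Summable fun d ↦ |densityCoeff k j d| := by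
  obtain ⟨C, -, hC⟩ := exists_abs_densityCoeff_le hk hkj hj
  exact Summable.of_nonneg_of_le (fun _ ↦ abs_nonneg _) hC
    ((Real.summable_nat_rpow.mpr (by norm_num)).mul_left C)

/-- The tail of the singular series beyond `z` is `O(z ^ (-1/2))`. -/
lemma exists_abs_sum_sub_tsum_le {k j : ℕ} (hk : 1 ≤ k) (hkj : k < j) (hj : j ≤ 3) :
    ∃ C : ℝ, 0 ≤ C ∧ ∀ z : ℝ, 0 < z →
      |(∑ d ∈ Finset.Icc 1 ⌊z⌋₊, densityCoeff k j d) - ∑' d, densityCoeff k j d| ≤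
        C * z ^ (-(1 / 2) : ℝ) := by
  obtain ⟨C, hC0, hC⟩ := exists_abs_densityCoeff_le hk hkj hj
  have hsum : Summable fun d : ℕ ↦ (d : ℝ) ^ (-(5 / 4) : ℝ) :=
    Real.summable_nat_rpow.mpr (by norm_num)
  refine ⟨C * ∑' d : ℕ, (d : ℝ) ^ (-(5 / 4) : ℝ), by positivity, fun z hz ↦ ?_⟩
  have hs := (summable_abs_densityCoeff hk hkj hj)
  have hs' : Summable (densityCoeff k j) := hs.of_abs
  set s := Finset.Icc 1 ⌊z⌋₊
  rw [← hs'.sum_add_tsum_compl (s := s), sub_add_cancel_left, abs_neg]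
  have hle : ∀ d : ((s : Set ℕ)ᶜ : Set ℕ), |densityCoeff k j d| ≤
      C * z ^ (-(1 / 2) : ℝ) * ((d : ℕ) : ℝ) ^ (-(5 / 4) : ℝ) := by
    rintro ⟨d, hd⟩
    rcases Nat.eq_zero_or_pos d with rfl | hd0
    · simp [densityCoeff]
    have hzd : z < d := by
      have : ¬ (1 ≤ d ∧ d ≤ ⌊z⌋₊) := by simpa [s] using hd
      exact (Nat.floor_lt hz.le).mp (by omega)
    have hd' : (0 : ℝ) < d := hz.trans hzd
    -- Half a power of `d > z` is given up; `d ^ (-5/4)` is still summable.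
    calc |densityCoeff k j d| ≤ C * (d : ℝ) ^ (-(7 / 4) : ℝ) := hC d
      _ = C * (d : ℝ) ^ (-(1 / 2) : ℝ) * (d : ℝ) ^ (-(5 / 4) : ℝ) := by
          rw [mul_assoc, ← Real.rpow_add hd']; norm_num
      _ ≤ _ := by
          gcongr ?_ * ?_ * _
          exact Real.rpow_le_rpow_of_nonpos hz hzd.le (by norm_num)
  have hsub := (hsum.mul_left (C * z ^ (-(1 / 2) : ℝ)))
  calc _ ≤ ∑' d : ((s : Set ℕ)ᶜ : Set ℕ), |densityCoeff k j d| := by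
        have := norm_tsum_le_tsum_norm (f := fun d : ((s : Set ℕ)ᶜ : Set ℕ) ↦ densityCoeff k j d)
          (hs.subtype _)
        simpa using this
    _ ≤ ∑' d : ((s : Set ℕ)ᶜ : Set ℕ), C * z ^ (-(1 / 2) : ℝ) * ((d : ℕ) : ℝ) ^ (-(5 / 4) : ℝ) :=
        (hs.subtype _).tsum_le_tsum hle (hsub.subtype _)
    _ ≤ ∑' d : ℕ, C * z ^ (-(1 / 2) : ℝ) * (d : ℝ) ^ (-(5 / 4) : ℝ) :=
        Summable.tsum_subtype_le _ _ (fun _ ↦ by positivity) hsub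
    _ = _ := by rw [tsum_mul_left]; ring

lemma densityCoeff_one (k j : ℕ) : densityCoeff k j 1 = 1 := by simp [densityCoeff, rootCount_one]

lemma densityCoeff_mul (k j : ℕ) {m n : ℕ} (h : m.Coprime n) :
    densityCoeff k j (m * n) = densityCoeff k j m * densityCoeff k j n := by
  rw [densityCoeff, densityCoeff, densityCoeff, rootCount_mul k j h,
    ArithmeticFunction.isMultiplicative_moebius.map_mul_of_coprime h]
  push_cast
  rw [div_mul_div_comm]
  ring

/-- Only the exponents `0` and `1` contribute, since `μ` vanishes on higher prime powers. -/
lemma tsum_densityCoeff_prime_pow (k j : ℕ) {p : ℕ} (hp : p.Prime) :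
    ∑' e, densityCoeff k j (p ^ e) = 1 - (rootCount k j p : ℝ) / (p : ℝ) ^ 2 := by
  rw [tsum_eq_sum (s := Finset.range 2)]
  · rw [Finset.sum_range_succ, Finset.sum_range_one, pow_zero, pow_one, densityCoeff_one,
      densityCoeff, ArithmeticFunction.moebius_apply_prime hp]
    push_cast
    ring
  · intro e he
    rw [Finset.mem_range] at he
    rw [densityCoeff, ArithmeticFunction.moebius_apply_prime_pow hp (by omega), if_neg (by omega)]
    simp

lemma eulerFactor_eq {k j : ℕ} (hk : 1 ≤ k) (hkj : k < j) (hj : j ≤ 3) (p : LargePrime) :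
    eulerFactor k j p = 1 - (rootCount k j (p.1 : ℕ) : ℝ) / ((p.1 : ℕ) : ℝ) ^ 2 := by
  have : Fact (Nat.Prime (p.1 : ℕ)) := ⟨p.1.2⟩
  have h := rootCount_prime p.2 hk hkj hj
  have h' : (rootCount k j (p.1 : ℕ) : ℝ) = 2 + (legendreSym (p.1 : ℕ) (-(k : ℤ)) : ℝ) +
      (legendreSym (p.1 : ℕ) (-(j : ℤ)) : ℝ) := by exact_mod_cast h
  rw [h', eulerFactor]

lemma multipliable_eulerFactor {k j : ℕ} (hk : 1 ≤ k) (hkj : k < j) (hj : j ≤ 3) :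
    Multipliable (eulerFactor k j) := by
  have h : eulerFactor k j = fun p : LargePrime ↦
      1 + -((rootCount k j (p.1 : ℕ) : ℝ) / ((p.1 : ℕ) : ℝ) ^ 2) := by
    funext p
    rw [eulerFactor_eq hk hkj hj, sub_eq_add_neg]
  rw [h]
  refine multipliable_one_add_of_summable ?_
  have hinj : Function.Injective fun p : LargePrime ↦ (p.1 : ℕ) :=
    Subtype.val_injective.comp Subtype.val_injective
  refine Summable.of_nonneg_of_le (fun _ ↦ norm_nonneg _) (fun p ↦ ?_)
    (((Real.summable_nat_pow_inv.mpr one_lt_two).mul_left 4).comp_injective hinj)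
  have : (rootCount k j (p.1 : ℕ) : ℝ) ≤ 4 := by
    exact_mod_cast rootCount_prime_le hk hkj hj p.1.2
  rw [norm_neg, Real.norm_of_nonneg (by positivity), div_eq_mul_inv]
  simp only [Function.comp_apply]
  gcongr

/-- The singular series factors as an Euler product, which is `Θ`. -/
lemma tsum_densityCoeff {k j : ℕ} (hk : 1 ≤ k) (hkj : k < j) (hj : j ≤ 3) :
    ∑' d, densityCoeff k j d = theta k j := by
  have h1 := EulerProduct.eulerProduct_hasProd (f := densityCoeff k j) (densityCoeff_one k j)
    (fun h ↦ densityCoeff_mul k j h) (summable_abs_densityCoeff hk hkj hj)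
    (by simp [densityCoeff])
  let F : Nat.Primes → ℝ := fun p ↦ 1 - (rootCount k j p : ℝ) / (p : ℝ) ^ 2
  have h1' : HasProd F (∑' d, densityCoeff k j d) := by
    have hF : F = fun p : Nat.Primes ↦ ∑' e, densityCoeff k j ((p : ℕ) ^ e) :=
      funext fun p ↦ (tsum_densityCoeff_prime_pow k j p.2).symm
    rw [hF]
    exact h1
  let p2 : Nat.Primes := ⟨2, Nat.prime_two⟩
  let p3 : Nat.Primes := ⟨3, Nat.prime_three⟩
  have hne : p2 ≠ p3 := fun h ↦ by simpa [p2, p3] using congrArg Subtype.val h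
  -- Separate the factors at `p ≤ 3` from those at `p > 3`.
  have hsmall := hasProd_prod_of_ne_finset_one (s := {p2, p3})
    (f := fun p : Nat.Primes ↦ if 3 < (p : ℕ) then 1 else F p) (L := .unconditional _) (by
      intro p hp
      rw [if_pos]
      by_contra hlt
      have := p.2.two_le
      apply hp
      rw [Finset.mem_insert, Finset.mem_singleton]
      have : (p : ℕ) = 2 ∨ (p : ℕ) = 3 := by omega
      exact this.imp Subtype.ext Subtype.ext)
  rw [Finset.prod_pair hne] at hsmall
  have hlarge : HasProd (fun p : Nat.Primes ↦ if 3 < (p : ℕ) then F p else 1)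
      (∏' p, eulerFactor k j p) := by
    have h := (multipliable_eulerFactor hk hkj hj).hasProd
    rw [← Function.Injective.hasProd_iff (g := (Subtype.val : LargePrime → Nat.Primes))
      Subtype.val_injective]
    · convert h using 1
      funext p
      simp only [Function.comp_apply, if_pos p.2]
      exact (eulerFactor_eq hk hkj hj p).symm
    · intro p hp
      rw [if_neg]
      exact fun h ↦ hp ⟨⟨p, h⟩, rfl⟩
  have hprod := hsmall.mul hlarge
  have hF : (fun p : Nat.Primes ↦ (if 3 < (p : ℕ) then 1 else F p) *
      (if 3 < (p : ℕ) then F p else 1)) = F := by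
    funext p; split_ifs <;> simp
  rw [hF] at hprod
  rw [h1'.unique hprod, theta, smallPrimesConst_eq hk hkj hj]
  simp [F, p2, p3]

/-! ### Error terms -/

/-- The number of positive `n ≤ X` with `d² ∣ (n² + k)(n² + j)`. -/
noncomputable def divisibleCount (k j d : ℕ) (X : ℝ) : ℕ :=
  ((Finset.Icc 1 ⌊X⌋₊).filter fun n ↦ d ^ 2 ∣ quartic k j n).card

open Classical in
/-- The positive `n ≤ X` for which `n² + l` is divisible by the square of a squarefree
`d > X ^ (1/3)`. -/
noncomputable def exceptional (l : ℕ) (X : ℝ) : Finset ℕ :=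
  (Finset.Icc 1 ⌊X⌋₊).filter fun n ↦
    ∃ d : ℕ, Squarefree d ∧ X ^ (1 / 3 : ℝ) < d ∧ d ^ 2 ∣ n ^ 2 + l

lemma sum_moebius_mul_divisibleCount_le {k j : ℕ} (hk : 1 ≤ k) (hkj : k < j) (hj : j ≤ 3) {ε : ℝ}
    (hε : 0 < ε) : ∃ C : ℝ, ∀ X : ℝ, 1 ≤ X →
      |(∑ d ∈ Finset.Icc 1 ⌊X ^ (2 / 3 : ℝ)⌋₊,
          (ArithmeticFunction.moebius d : ℝ) * divisibleCount k j d X) -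
        X * ∑ d ∈ Finset.Icc 1 ⌊X ^ (2 / 3 : ℝ)⌋₊, densityCoeff k j d| ≤
      C * X ^ (2 / 3 + ε) := by
  obtain ⟨C, hC1, hC⟩ := exists_moebius_mul_rootCount_le hk hkj hj hε
  refine ⟨C, fun X hX ↦ ?_⟩
  have hX0 : 0 < X := by linarith
  have hz : X ^ (2 / 3 : ℝ) ≤ X :=
    (Real.rpow_le_rpow_of_exponent_le hX (by norm_num)).trans_eq (Real.rpow_one X)
  rw [Finset.mul_sum, ← Finset.sum_sub_distrib]
  calc _ ≤ ∑ d ∈ Finset.Icc 1 ⌊X ^ (2 / 3 : ℝ)⌋₊, C * X ^ ε := by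
        refine (Finset.abs_sum_le_sum_abs _ _).trans (Finset.sum_le_sum fun d hd ↦ ?_)
        rw [Finset.mem_Icc] at hd
        have hdX : (d : ℝ) ≤ X :=
          ((Nat.cast_le.mpr hd.2).trans (Nat.floor_le (by positivity))).trans hz
        have h1 : (ArithmeticFunction.moebius d : ℝ) * divisibleCount k j d X -
            X * densityCoeff k j d = (ArithmeticFunction.moebius d : ℝ) *
              (divisibleCount k j d X - X * rootCount k j d / (d : ℝ) ^ 2) := by
          rw [densityCoeff]; ring
        rw [h1, abs_mul]
        calc _ ≤ |(ArithmeticFunction.moebius d : ℝ)| * rootCount k j d := by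
              gcongr
              exact abs_card_sub_le k j hd.1 hX0.le
          _ ≤ C * (d : ℝ) ^ ε := hC d hd.1
          _ ≤ C * X ^ ε := by gcongr
    _ = ⌊X ^ (2 / 3 : ℝ)⌋₊ * (C * X ^ ε) := by simp
    _ ≤ X ^ (2 / 3 : ℝ) * (C * X ^ ε) := by
        gcongr
        exact Nat.floor_le (by positivity)
    _ = C * X ^ (2 / 3 + ε) := by rw [Real.rpow_add hX0]; ring

lemma card_large_sq_dvd_le_rpow {l : ℕ} (hl : 1 ≤ l) (hl3 : l ≤ 3) {ε : ℝ} (hε : 0 < ε) :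
    ∃ C : ℝ, ∀ X : ℝ, 1 ≤ X → ∀ S ⊆ Finset.Icc 1 ⌊X⌋₊,
      (∀ n ∈ S, ∃ d : ℕ, X ^ (2 / 3 : ℝ) < d ∧ d ^ 2 ∣ n ^ 2 + l) →
        (S.card : ℝ) ≤ C * X ^ (2 / 3 + ε) := by
  classical
  set K : ℝ := max 1 (1 / (ε * Real.log 2))
  have hK : 0 ≤ K := zero_le_one.trans (le_max_left _ _)
  refine ⟨5 * (9 * K), fun X hX S hS hdS ↦ ?_⟩
  have hX0 : 0 < X := by linarith
  have hz1 : 1 ≤ X ^ (2 / 3 : ℝ) := Real.one_le_rpow hX (by norm_num)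
  have hN : (⌊X⌋₊ : ℝ) ≤ X := Nat.floor_le hX0.le
  have hN1 : ⌊X⌋₊ ≠ 0 := (Nat.floor_pos.mpr hX).ne'
  have hM : ((⌊X⌋₊ : ℝ) ^ 2 + 3) / (X ^ (2 / 3 : ℝ)) ^ 2 ≤ ⌈4 * X ^ (2 / 3 : ℝ)⌉₊ := by
    refine le_trans ?_ (Nat.le_ceil _)
    rw [div_le_iff₀ (by positivity)]
    have h3 : 4 * X ^ (2 / 3 : ℝ) * (X ^ (2 / 3 : ℝ)) ^ 2 = 4 * X ^ 2 := by
      rw [mul_assoc, ← pow_succ', ← Real.rpow_natCast (X ^ (2 / 3 : ℝ)), ← Real.rpow_mul hX0.le]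
      norm_num
    rw [h3]
    nlinarith [Nat.cast_nonneg (α := ℝ) ⌊X⌋₊]
  have hcard := card_large_sq_dvd_le hl hl3 (by positivity) hM
  have hsub : S.card ≤ _ := (Finset.card_le_card fun n hn ↦
    Finset.mem_filter.mpr ⟨hS hn, hdS n hn⟩).trans hcard
  have hM' : (⌈4 * X ^ (2 / 3 : ℝ)⌉₊ : ℝ) ≤ 5 * X ^ (2 / 3 : ℝ) := by
    have := Nat.ceil_lt_add_one (a := 4 * X ^ (2 / 3 : ℝ)) (by positivity)
    linarith
  have hlog : ((Nat.log 2 ⌊X⌋₊ : ℝ) + 1) ≤ K * X ^ ε := by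
    refine (succ_le_mul_two_rpow hε _).trans ?_
    rw [Real.rpow_mul two_pos.le, Real.rpow_natCast]
    gcongr
    refine le_trans ?_ hN
    exact_mod_cast Nat.pow_log_le_self 2 hN1
  calc (S.card : ℝ) ≤ ⌈4 * X ^ (2 / 3 : ℝ)⌉₊ * (9 * ((Nat.log 2 ⌊X⌋₊ : ℝ) + 1)) := by
        exact_mod_cast hsub
    _ ≤ (5 * X ^ (2 / 3 : ℝ)) * (9 * (K * X ^ ε)) := by gcongr
    _ = _ := by rw [Real.rpow_add hX0]; ring

/-- Square divisors `d²` with `X ^ (1/3) < d ≤ X ^ (2/3)` are handled by counting roots modulo `d²`,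
the remaining ones by counting solutions of `n² + l = m d²`. -/
lemma card_exceptional_le {k j l : ℕ} (hk : 1 ≤ k) (hkj : k < j) (hj : j ≤ 3)
    (hl : l = k ∨ l = j) {ε : ℝ} (hε : 0 < ε) :
    ∃ C : ℝ, ∀ X : ℝ, 1 ≤ X → ((exceptional l X).card : ℝ) ≤ C * X ^ (2 / 3 + ε) := by
  classical
  obtain ⟨C, hC1, hC⟩ := exists_moebius_mul_rootCount_le hk hkj hj hε
  obtain ⟨C', hC'⟩ := card_large_sq_dvd_le_rpow (l := l) (by omega) (by omega) hε
  refine ⟨C * 3 + C', fun X hX ↦ ?_⟩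
  have hX0 : 0 < X := by linarith
  set D := X ^ (1 / 3 : ℝ) with hD
  set z := X ^ (2 / 3 : ℝ) with hz
  have hD0 : 0 < D := by positivity
  have hz0 : 0 < z := by positivity
  have hzX : z ≤ X :=
    (Real.rpow_le_rpow_of_exponent_le hX (by norm_num)).trans_eq (Real.rpow_one X)
  set I := (Finset.Ioo ⌊D⌋₊ (⌊z⌋₊ + 1)).filter Squarefree with hI
  set B := I.biUnion fun d ↦ (Finset.Icc 1 ⌊X⌋₊).filter fun n ↦ d ^ 2 ∣ quartic k j n with hB
  set S := exceptional l X \ B with hS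
  have hScard : (S.card : ℝ) ≤ C' * X ^ (2 / 3 + ε) := by
    refine hC' X hX S (fun n hn ↦ ?_) fun n hn ↦ ?_
    · exact (Finset.mem_filter.mp (Finset.mem_sdiff.mp hn).1).1
    · obtain ⟨hn1, hn2⟩ := Finset.mem_sdiff.mp hn
      obtain ⟨hnX, d, hsq, hDd, hd⟩ := Finset.mem_filter.mp hn1
      refine ⟨d, ?_, hd⟩
      by_contra! hdz
      refine hn2 (Finset.mem_biUnion.mpr ⟨d, ?_, ?_⟩)
      · rw [hI, Finset.mem_filter, Finset.mem_Ioo]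
        exact ⟨⟨(Nat.floor_lt hD0.le).mpr hDd, Nat.lt_succ_of_le (Nat.le_floor hdz)⟩, hsq⟩
      · refine Finset.mem_filter.mpr ⟨hnX, ?_⟩
        rcases hl with rfl | rfl
        · exact hd.mul_right _
        · exact hd.mul_left _
  have hBcard : (B.card : ℝ) ≤ C * 3 * X ^ (2 / 3 + ε) := by
    have hterm : ∀ d ∈ I, (divisibleCount k j d X : ℝ) ≤
        C * X ^ ε * (X * ((d : ℝ) ^ 2)⁻¹ + 1) := by
      intro d hd
      rw [hI, Finset.mem_filter, Finset.mem_Ioo] at hd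
      have hd0 : 0 < d := by omega
      have hdX : (d : ℝ) ≤ X := by
        have h : (d : ℝ) ≤ ⌊z⌋₊ := by exact_mod_cast Nat.lt_succ_iff.mp hd.1.2
        exact (h.trans (Nat.floor_le hz0.le)).trans hzX
      have h1 := (abs_le.mp (abs_card_sub_le k j hd0 hX0.le)).2
      have h2 := hC d hd0
      rw [← Int.cast_abs, ArithmeticFunction.abs_moebius_eq_one_of_squarefree hd.2, Int.cast_one,
        one_mul] at h2
      calc (divisibleCount k j d X : ℝ) ≤ X * rootCount k j d / (d : ℝ) ^ 2 + rootCount k j d := by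
            rw [divisibleCount]; linarith
        _ = rootCount k j d * (X * ((d : ℝ) ^ 2)⁻¹ + 1) := by ring
        _ ≤ C * (d : ℝ) ^ ε * (X * ((d : ℝ) ^ 2)⁻¹ + 1) := by gcongr
        _ ≤ _ := by gcongr
    have hsum : ∑ d ∈ I, (X * ((d : ℝ) ^ 2)⁻¹ + 1) ≤ 3 * z := by
      rw [Finset.sum_add_distrib, ← Finset.mul_sum]
      have h1 : ∑ d ∈ I, ((d : ℝ) ^ 2)⁻¹ ≤ 2 / D :=
        calc _ ≤ ∑ d ∈ Finset.Ioo ⌊D⌋₊ (⌊z⌋₊ + 1), ((d : ℝ) ^ 2)⁻¹ :=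
              Finset.sum_le_sum_of_subset_of_nonneg (Finset.filter_subset _ _)
                fun _ _ _ ↦ by positivity
          _ ≤ 2 / (⌊D⌋₊ + 1) := sum_Ioo_inv_sq_le _ _
          _ ≤ 2 / D := by gcongr; exact (Nat.lt_floor_add_one D).le
      have h2 : ∑ d ∈ I, (1 : ℝ) ≤ z := by
        rw [Finset.sum_const, nsmul_one]
        refine le_trans ?_ (Nat.floor_le hz0.le)
        exact_mod_cast (Finset.card_filter_le _ _).trans (by rw [Nat.card_Ioo]; omega)
      have h3 : X * (2 / D) = 2 * z := by
        have : X = D * z := by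
          rw [hD, hz, ← Real.rpow_add hX0]; norm_num
        rw [this]; field_simp
      have := mul_le_mul_of_nonneg_left h1 hX0.le
      linarith
    calc (B.card : ℝ) ≤ ∑ d ∈ I, (divisibleCount k j d X : ℝ) := by
          exact_mod_cast Finset.card_biUnion_le
      _ ≤ ∑ d ∈ I, C * X ^ ε * (X * ((d : ℝ) ^ 2)⁻¹ + 1) := Finset.sum_le_sum hterm
      _ = C * X ^ ε * ∑ d ∈ I, (X * ((d : ℝ) ^ 2)⁻¹ + 1) := by rw [Finset.mul_sum]
      _ ≤ C * X ^ ε * (3 * z) := by gcongr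
      _ = _ := by rw [Real.rpow_add hX0]; ring
  have hle : (exceptional l X).card ≤ B.card + S.card := by
    have : exceptional l X ⊆ B ∪ S := fun n hn ↦ by
      by_cases h : n ∈ B
      · exact Finset.mem_union_left _ h
      · exact Finset.mem_union_right _ (Finset.mem_sdiff.mpr ⟨hn, h⟩)
    exact (Finset.card_le_card this).trans (Finset.card_union_le _ _)
  calc ((exceptional l X).card : ℝ) ≤ B.card + S.card := by exact_mod_cast hle
    _ ≤ _ := by linarith

/-- The Möbius terms with `d > X ^ (2/3)`: such a `d` is a product `d₁ d₂` with one factor above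
`X ^ (1/3)`, so only exceptional `n` contribute, each at most its number of divisors. -/
lemma sum_moebius_large_le {k j : ℕ} (hk : 1 ≤ k) (hkj : k < j) (hj : j ≤ 3) {ε : ℝ}
    (hε : 0 < ε) : ∃ C : ℝ, ∀ X : ℝ, 1 ≤ X →
      |∑ n ∈ Finset.Icc 1 ⌊X⌋₊, ∑ d ∈ (quartic k j n).divisors with
          d ^ 2 ∣ quartic k j n ∧ ¬ d ≤ ⌊X ^ (2 / 3 : ℝ)⌋₊, (ArithmeticFunction.moebius d : ℝ)| ≤
      C * X ^ (2 / 3 + ε) := by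
  classical
  obtain ⟨C, hC1, hC⟩ := exists_card_divisors_le (δ := ε / 8) (by positivity)
  obtain ⟨C₁, hC₁⟩ := card_exceptional_le hk hkj hj (Or.inl rfl) (half_pos hε)
  obtain ⟨C₂, hC₂⟩ := card_exceptional_le hk hkj hj (Or.inr rfl) (half_pos hε)
  refine ⟨(C₁ + C₂) * (C * 16 ^ (ε / 8)), fun X hX ↦ ?_⟩
  have hX0 : 0 < X := by linarith
  set E := exceptional k X ∪ exceptional j X with hE
  have hES : E ⊆ Finset.Icc 1 ⌊X⌋₊ :=
    Finset.union_subset (Finset.filter_subset _ _) (Finset.filter_subset _ _)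
  have hzero : ∀ n ∈ Finset.Icc 1 ⌊X⌋₊, n ∉ E → ∑ d ∈ (quartic k j n).divisors with
      d ^ 2 ∣ quartic k j n ∧ ¬ d ≤ ⌊X ^ (2 / 3 : ℝ)⌋₊, (ArithmeticFunction.moebius d : ℝ) = 0 := by
    intro n hn hnE
    refine Finset.sum_eq_zero fun d hd ↦ ?_
    obtain ⟨-, hdF, hdz⟩ := Finset.mem_filter.mp hd
    by_contra hμ
    have hsq : Squarefree d := ArithmeticFunction.moebius_ne_zero_iff_squarefree.mp
      fun h ↦ hμ (by rw [h, Int.cast_zero])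
    obtain ⟨d₁, d₂, rfl, h1, h2⟩ := exists_mul_eq_of_sq_dvd_quartic hk hkj hj hsq hdF
    rw [hE, Finset.mem_union, not_or] at hnE
    have hd1 : (d₁ : ℝ) ≤ X ^ (1 / 3 : ℝ) := by
      by_contra! h
      exact hnE.1 (Finset.mem_filter.mpr ⟨hn, d₁, hsq.of_mul_left, h, h1⟩)
    have hd2 : (d₂ : ℝ) ≤ X ^ (1 / 3 : ℝ) := by
      by_contra! h
      exact hnE.2 (Finset.mem_filter.mpr ⟨hn, d₂, hsq.of_mul_right, h, h2⟩)
    refine hdz (Nat.le_floor ?_)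
    have hDD : X ^ (2 / 3 : ℝ) = X ^ (1 / 3 : ℝ) * X ^ (1 / 3 : ℝ) := by
      rw [← Real.rpow_add hX0]; norm_num
    rw [hDD, Nat.cast_mul]
    gcongr
  have hterm : ∀ n ∈ E, |∑ d ∈ (quartic k j n).divisors with
      d ^ 2 ∣ quartic k j n ∧ ¬ d ≤ ⌊X ^ (2 / 3 : ℝ)⌋₊, (ArithmeticFunction.moebius d : ℝ)| ≤
      C * 16 ^ (ε / 8) * X ^ (ε / 2) := by
    intro n hn
    have hnX : (n : ℝ) ≤ X := by
      have := (Finset.mem_Icc.mp (hES hn)).2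
      exact (Nat.cast_le.mpr this).trans (Nat.floor_le hX0.le)
    have hF : (quartic k j n : ℝ) ≤ 16 * X ^ 4 := by
      have h1 : ∀ l : ℕ, l ≤ 3 → (n : ℝ) ^ 2 + l ≤ 4 * X ^ 2 := fun l hl ↦ by
        have : (l : ℝ) ≤ 3 := by exact_mod_cast hl
        nlinarith [Nat.cast_nonneg (α := ℝ) n]
      rw [quartic]
      push_cast
      calc ((n : ℝ) ^ 2 + k) * ((n : ℝ) ^ 2 + j) ≤ (4 * X ^ 2) * (4 * X ^ 2) :=
            mul_le_mul (h1 k (by omega)) (h1 j hj) (by positivity) (by positivity)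
        _ = _ := by ring
    calc _ ≤ ∑ d ∈ (quartic k j n).divisors with
          d ^ 2 ∣ quartic k j n ∧ ¬ d ≤ ⌊X ^ (2 / 3 : ℝ)⌋₊, (1 : ℝ) := by
          refine (Finset.abs_sum_le_sum_abs _ _).trans (Finset.sum_le_sum fun d _ ↦ ?_)
          exact_mod_cast ArithmeticFunction.abs_moebius_le_one
      _ ≤ ((quartic k j n).divisors.card : ℝ) := by
          rw [Finset.sum_const, nsmul_one]
          exact_mod_cast Finset.card_filter_le _ _
      _ ≤ C * (quartic k j n : ℝ) ^ (ε / 8) := hC _ (quartic_ne_zero hk hkj)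
      _ ≤ C * (16 * X ^ 4) ^ (ε / 8) := by gcongr
      _ = _ := by
          rw [Real.mul_rpow (by norm_num) (by positivity), ← Real.rpow_natCast X 4,
            ← Real.rpow_mul hX0.le, mul_assoc]
          congr 3
          push_cast; ring
  have hcard : (E.card : ℝ) ≤ (C₁ + C₂) * X ^ (2 / 3 + ε / 2) := by
    have : (E.card : ℝ) ≤ (exceptional k X).card + (exceptional j X).card := by
      exact_mod_cast Finset.card_union_le _ _
    linarith [hC₁ X hX, hC₂ X hX]
  rw [← Finset.sum_subset hES hzero]
  calc _ ≤ ∑ n ∈ E, C * 16 ^ (ε / 8) * X ^ (ε / 2) :=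
        (Finset.abs_sum_le_sum_abs _ _).trans (Finset.sum_le_sum hterm)
    _ = E.card * (C * 16 ^ (ε / 8) * X ^ (ε / 2)) := by rw [Finset.sum_const, nsmul_eq_mul]
    _ ≤ (C₁ + C₂) * X ^ (2 / 3 + ε / 2) * (C * 16 ^ (ε / 8) * X ^ (ε / 2)) := by gcongr
    _ = (C₁ + C₂) * (C * 16 ^ (ε / 8)) * (X ^ (2 / 3 + ε / 2) * X ^ (ε / 2)) := by ring
    _ = _ := by
        rw [← Real.rpow_add hX0, add_assoc, add_halves]

lemma pairSum_eq_add {k j : ℕ} (hk : 1 ≤ k) (hkj : k < j) (hj : j ≤ 3) (X : ℝ) (Z : ℕ) :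
    pairSum k j X =
      (∑ d ∈ Finset.Icc 1 Z, (ArithmeticFunction.moebius d : ℝ) * divisibleCount k j d X) +
      ∑ n ∈ Finset.Icc 1 ⌊X⌋₊, ∑ d ∈ (quartic k j n).divisors with
          d ^ 2 ∣ quartic k j n ∧ ¬ d ≤ Z, (ArithmeticFunction.moebius d : ℝ) := by
  have hswap : ∑ d ∈ Finset.Icc 1 Z, (ArithmeticFunction.moebius d : ℝ) * divisibleCount k j d X =
      ∑ n ∈ Finset.Icc 1 ⌊X⌋₊, ∑ d ∈ Finset.Icc 1 Z with d ^ 2 ∣ quartic k j n,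
        (ArithmeticFunction.moebius d : ℝ) := by
    simp_rw [Finset.sum_filter]
    rw [Finset.sum_comm]
    refine Finset.sum_congr rfl fun d _ ↦ ?_
    rw [← Finset.sum_filter, Finset.sum_const, nsmul_eq_mul, mul_comm]
    rfl
  rw [pairSum_eq hk hkj hj, hswap, ← Finset.sum_add_distrib]
  refine Finset.sum_congr rfl fun n _ ↦ ?_
  rw [← Finset.sum_filter_add_sum_filter_not _ (fun d ↦ d ≤ Z), Finset.filter_filter,
    Finset.filter_filter]
  congr 1
  refine Finset.sum_congr ?_ fun _ _ ↦ rfl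
  ext d
  have hF := quartic_ne_zero (n := n) hk hkj
  simp only [Finset.mem_filter, Nat.mem_divisors, Finset.mem_Icc]
  constructor
  · rintro ⟨⟨h1, -⟩, h2, h3⟩
    exact ⟨⟨Nat.pos_of_dvd_of_pos h1 (Nat.pos_of_ne_zero hF), h3⟩, h2⟩
  · rintro ⟨⟨-, h3⟩, h2⟩
    exact ⟨⟨(dvd_pow_self d two_ne_zero).trans h2, hF⟩, h2, h3⟩

lemma exists_abs_pairSum_sub_le {k j : ℕ} (hk : 1 ≤ k) (hkj : k < j) (hj : j ≤ 3) {ε : ℝ}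
    (hε : 0 < ε) : ∃ C : ℝ, ∀ X : ℝ, 1 ≤ X →
      |pairSum k j X - theta k j * X| ≤ C * X ^ (2 / 3 + ε) := by
  obtain ⟨C₁, hC₁⟩ := sum_moebius_mul_divisibleCount_le hk hkj hj hε
  obtain ⟨C₂, hC₂⟩ := sum_moebius_large_le hk hkj hj hε
  obtain ⟨C₃, hC₃0, hC₃⟩ := exists_abs_sum_sub_tsum_le hk hkj hj
  refine ⟨C₁ + C₂ + C₃, fun X hX ↦ ?_⟩
  have hX0 : 0 < X := by linarith
  have h1 := hC₁ X hX
  have h2 := hC₂ X hX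
  have h3 := hC₃ (X ^ (2 / 3 : ℝ)) (by positivity)
  rw [tsum_densityCoeff hk hkj hj] at h3
  have h3' : |X * ((∑ d ∈ Finset.Icc 1 ⌊X ^ (2 / 3 : ℝ)⌋₊, densityCoeff k j d) - theta k j)| ≤
      C₃ * X ^ (2 / 3 + ε) := by
    rw [abs_mul, abs_of_pos hX0]
    calc _ ≤ X * (C₃ * (X ^ (2 / 3 : ℝ)) ^ (-(1 / 2) : ℝ)) := by gcongr
      _ = C₃ * X ^ (2 / 3 : ℝ) := by
          rw [← Real.rpow_mul hX0.le, mul_left_comm]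
          nth_rewrite 1 [← Real.rpow_one X]
          rw [← Real.rpow_add hX0]
          norm_num
      _ ≤ _ := by
          gcongr
          linarith
  rw [pairSum_eq_add hk hkj hj X ⌊X ^ (2 / 3 : ℝ)⌋₊]
  rw [abs_le] at *
  constructor <;> linarith [h1.1, h1.2, h2.1, h2.2, h3'.1, h3'.2]

end NearSquare

theorem proposition3 (k j : ℕ) (hk : 1 ≤ k) (hkj : k < j) (hj : j ≤ 3) :
    Multipliable (NearSquare.eulerFactor k j) ∧
      ∀ ε : ℝ, 0 < ε →
        (fun X : ℝ => NearSquare.pairSum k j X - NearSquare.theta k j * X)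
          =O[atTop] (fun X : ℝ => X ^ (2 / 3 + ε : ℝ)) := by
  refine ⟨NearSquare.multipliable_eulerFactor hk hkj hj, fun ε hε ↦ ?_⟩
  obtain ⟨C, hC⟩ := NearSquare.exists_abs_pairSum_sub_le hk hkj hj hε
  refine IsBigO.of_bound C ?_
  filter_upwards [eventually_ge_atTop 1] with X hX
  rw [Real.norm_eq_abs, Real.norm_of_nonneg (by positivity)]
  exact hC X hX
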